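/- Let $F$ be a free group of finite rank with a chosen finite set of free generators, and let $T=(V,E)$ be the corresponding tree: $V=F$, with an oriented edge labelled $s$ from $x$ to $xs$ for every $x\in F$ and every letter $s$ (a generator or the inverse of a generator), the reverse edge being the edge from $xs$ to $x$ labelled $s^{-1}$. Left multiplication embeds $F$ in $\mathrm{Aut}(T)$, which carries the topology of pointwise convergence on the discrete set $V$. A path is a sequence $p=(e_1,\dots,e_n)$, $n\ge 1$, of successive oriented edges without backtracking; $\overline p$ is the reverse path and $[x_0,x_1]$ is the sequence of oriented edges joining $x_0$ to $x_1$ without backtracking (empty if $x_0=x_1$). A sequence of edges is labelled by the word formed by the labels of its edges. Let $P$ be the space of finitely supported real functions $\alpha$ on the set of paths with $\alpha(\overline p)=-\alpha(p)$ for all $p$, normed by $\|\alpha\|=\sum_p|\alpha(p)|/n(p)!$, where $n(p)$ is the length of $p$, and let $\overline P$ be its completion, an isometric $\mathrm{Aut}(T)$-module. Define $\theta\colon V^2\to P$ by: $\theta(x_0,x_1)(p)$ equals $1$ if $p$ is a sub-path of $[x_0,x_1]$, $-1$ if $\overline p$ is, and $0$ otherwise; and let $\omega=d\theta\colon V^3\to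 P$, that is $\omega(x_0,x_1,x_2)=\theta(x_1,x_2)-\theta(x_0,x_2)+\theta(x_0,x_1)$. For a topological group $G$ and an isometric Banach $G$-module $E$, let $H^n_{cb}(G,E)$ be the cohomology of the complex of continuous bounded $G$-equivariant maps $G^{n+1}\to E$ with the usual homogeneous coboundary; for discrete $G$ it is written $H^n_b(G,E)$. Let $w$ be a reduced word in the generators (possibly trivial), and let $f_w(g)$ be the number of occurrences of $w$ (overlaps allowed) in the reduced word of $g$ minus the number of occurrences of $w$ in the reduced word of $g^{-1}$. Let $\lambda_w$ be the $F$-invariant bounded linear form on $P$, extended to $\overline P$, whose value on $p-\overline p\in P$ is, for every path $p$, $1$ if $w$ labels $p$, $-1$ if $w$ labels $\overline p$, and $0$ otherwise. Then: 1. If the reduced word of $g\in F$ labels $[x_0,x_1]$, then $\lambda_w(\theta(x_0,x_1))=f_w(g)$. 2. For every vertex $v$, the map $(g_0,g_1,g_2)\mapsto\omega(g_0v,g_1v,g_2v)$ is a continuous bounded $\mathrm{Aut}(T)$-equivariant cocycle with values in $\overline P$, and its class $[\omega]\in H^2_{cb}(\mathrm{Aut}(T),\overline P)$ does not depend on $v$.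 The map $(g_0,g_1,g_2)\mapsto f_w(g_1^{-1}g_2)-f_w(g_0^{-1}g_2)+f_w(g_0^{-1}g_1)$ is a bounded $F$-invariant cocycle; let $\beta_w\in H^2_b(F,\mathbb R)$ be its class. Then $\beta_w$ is the image of $[\omega]$ under $$H^2_{cb}(\mathrm{Aut}(T),\overline P)\xrightarrow{\ \mathrm{rest}\ }H^2_b(F,\overline P)\xrightarrow{\ (\lambda_w)_*\ }H^2_b(F,\mathbb R),$$ where the first map is restriction to $F$ and the second is induced by $\lambda_w$. -/

import Mathlib

open UniformSpace

noncomputable section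

/-! ### Continuous bounded cohomology -/

namespace BddCoh

section Defs

variable {G : Type*} [Group G] [TopologicalSpace G]
  {E : Type*} [NormedAddCommGroup E] [NormedSpace ℝ E]

/-- The usual homogeneous coboundary: the alternating sum of the maps omitting one variable. -/
def d (X : Type*) (E : Type*) [AddCommGroup E] [Module ℝ E] (n : ℕ) :
    ((Fin (n + 1) → X) → E) →ₗ[ℝ] ((Fin (n + 2) → X) → E) where
  toFun f := fun x => ∑ i : Fin (n + 2), (-1 : ℝ) ^ (i : ℕ) • f (fun j => x (i.succAbove j))
  map_add' f g := by
    funext x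
    simp [Finset.sum_add_distrib]
  map_smul' c f := by
    funext x
    simp [Finset.smul_sum, smul_comm c]

/-- Continuous bounded `G`-equivariant maps `G ^ (n + 1) → E`, for an isometric action of `G`
on `E`. -/
def cochains (ρ : G →* (E ≃ₗᵢ[ℝ] E)) (n : ℕ) : Submodule ℝ ((Fin (n + 1) → G) → E) where
  carrier := {f | Continuous f ∧ (∃ C : ℝ, ∀ x, ‖f x‖ ≤ C) ∧
    ∀ (g : G) (x : Fin (n + 1) → G), f (fun i => g * x i) = ρ g (f x)}
  add_mem' := by
    rintro f f' ⟨hc, ⟨C, hC⟩, he⟩ ⟨hc', ⟨C', hC'⟩, he'⟩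
    exact ⟨hc.add hc', ⟨C + C', fun x => (norm_add_le _ _).trans (add_le_add (hC x) (hC' x))⟩,
      fun g x => by simp [he, he']⟩
  zero_mem' := ⟨continuous_const, ⟨0, fun x => by simp⟩, fun g x => by simp⟩
  smul_mem' := by
    rintro c f ⟨hc, ⟨C, hC⟩, he⟩
    refine ⟨hc.const_smul c, ⟨‖c‖ * C, fun x => ?_⟩, fun g x => by simp [he]⟩
    rw [Pi.smul_apply, norm_smul]
    exact mul_le_mul_of_nonneg_left (hC x) (norm_nonneg c)

/-- Continuous bounded cocycles. -/
def cocycles (ρ : G →* (E ≃ₗᵢ[ℝ] E)) (n : ℕ) : Submodule ℝ ((Fin (n + 1) → G) → E) :=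
  cochains ρ n ⊓ LinearMap.ker (d G E n)

/-- Coboundaries of continuous bounded cochains (there are none in degree `0`). -/
def coboundaries (ρ : G →* (E ≃ₗᵢ[ℝ] E)) : (n : ℕ) → Submodule ℝ ((Fin (n + 1) → G) → E)
  | 0 => ⊥
  | n + 1 => (cochains ρ n).map (d G E n)

/-- The continuous bounded cohomology of `G` with coefficients in `(E, ρ)`; for discrete `G` this
is bounded cohomology. -/
abbrev H (ρ : G →* (E ≃ₗᵢ[ℝ] E)) (n : ℕ) : Type _ :=
  cocycles ρ n ⧸ (coboundaries ρ n).submoduleOf (cocycles ρ n)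

/-- The class of a cocycle. -/
def mk (ρ : G →* (E ≃ₗᵢ[ℝ] E)) (n : ℕ) (f : (Fin (n + 1) → G) → E) (hf : f ∈ cocycles ρ n) :
    H ρ n :=
  Submodule.Quotient.mk ⟨f, hf⟩

end Defs

section Maps

variable {G : Type*} [Group G] [TopologicalSpace G] {G' : Type*} [Group G'] [TopologicalSpace G']
  {E : Type*} [NormedAddCommGroup E] [NormedSpace ℝ E]
  {E' : Type*} [NormedAddCommGroup E'] [NormedSpace ℝ E']

/-- The map induced in cohomology by a morphism of complexes. -/
def induced (ρ : G →* (E ≃ₗᵢ[ℝ] E)) (ρ' : G' →* (E' ≃ₗᵢ[ℝ] E'))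
    (Φ : ∀ n : ℕ, ((Fin (n + 1) → G) → E) →ₗ[ℝ] ((Fin (n + 1) → G') → E'))
    (hΦ : ∀ n, ∀ f ∈ cochains ρ n, Φ n f ∈ cochains ρ' n)
    (hd : ∀ n, ∀ f ∈ cochains ρ n, d G' E' n (Φ n f) = Φ (n + 1) (d G E n f)) (n : ℕ) :
    H ρ n →ₗ[ℝ] H ρ' n :=
  Submodule.mapQ _ _
    ((Φ n).restrict (p := cocycles ρ n) (q := cocycles ρ' n) (fun f hf =>
      ⟨hΦ n f hf.1, by
        have h0 : d G E n f = 0 := hf.2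
        change d G' E' n (Φ n f) = 0
        rw [hd n f hf.1, h0, map_zero]⟩))
    (by
      rintro ⟨f, hf⟩ hb
      change Φ n f ∈ coboundaries ρ' n
      change f ∈ coboundaries ρ n at hb
      cases n with
      | zero =>
        have h0 : f = 0 := hb
        rw [h0, map_zero]
        exact Submodule.zero_mem _
      | succ n =>
        obtain ⟨e, he, hef⟩ := hb
        refine ⟨Φ n e, hΦ n e he, ?_⟩
        rw [hd n e he, hef])

/-- Restriction along a continuous homomorphism. -/
def res (ρ : G →* (E ≃ₗᵢ[ℝ] E)) (j : G' →* G) (hj : Continuous j) (n : ℕ) :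
    H ρ n →ₗ[ℝ] H (ρ.comp j) n :=
  induced ρ (ρ.comp j)
    (fun n => LinearMap.funLeft ℝ E (fun (x : Fin (n + 1) → G') i => j (x i)))
    (by
      rintro n f ⟨hc, ⟨C, hC⟩, he⟩
      refine ⟨hc.comp (by fun_prop), ⟨C, fun x => hC _⟩, fun g x => ?_⟩
      simp only [LinearMap.funLeft_apply, map_mul]
      exact he (j g) _)
    (fun n f _ => rfl) n

/-- The map induced by an equivariant bounded linear map between coefficient modules. -/
def coeffMap (ρ : G →* (E ≃ₗᵢ[ℝ] E)) (ρ' : G →* (E' ≃ₗᵢ[ℝ] E')) (L : E →L[ℝ] E')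
    (hL : ∀ g v, L (ρ g v) = ρ' g (L v)) (n : ℕ) :
    H ρ n →ₗ[ℝ] H ρ' n :=
  induced ρ ρ' (fun n => L.toLinearMap.compLeft (Fin (n + 1) → G))
    (by
      rintro n f ⟨hc, ⟨C, hC⟩, he⟩
      refine ⟨L.continuous.comp hc, ⟨‖L‖ * C, fun x => ?_⟩, fun g x => ?_⟩
      · exact (L.le_opNorm _).trans (mul_le_mul_of_nonneg_left (hC x) (norm_nonneg L))
      · exact (congrArg L (he g x)).trans (hL g _))
    (fun n f _ => by
      funext x
      simp [d]) n

end Maps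

end BddCoh

/-! ### Trees, paths and the path module -/

namespace TreePaths

section Graph

variable {V : Type*} (T : SimpleGraph V)

/-- The topology of pointwise convergence on the automorphism group (with `V` discrete). -/
instance autTopology : TopologicalSpace (T ≃g T) :=
  TopologicalSpace.induced (fun g : T ≃g T => (g : V → V))
    (@Pi.topologicalSpace V (fun _ => V) (fun _ => ⊥))

/-- Successive oriented edges without backtracking. -/
def Succ (e e' : T.Dart) : Prop := e.snd = e'.fst ∧ e' ≠ e.symm

/-- Paths: non-empty sequences of successive oriented edges without backtracking. -/
def EdgePath : Type _ := {l : List T.Dart // l ≠ [] ∧ l.IsChain (Succ T)}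

variable {T}

/-- The edges of a path. -/
def EdgePath.edges (p : EdgePath T) : List T.Dart := p.1

/-- The length of a path. -/
def EdgePath.length (p : EdgePath T) : ℕ := p.edges.length

/-- The reverse path. -/
def EdgePath.rev (p : EdgePath T) : EdgePath T :=
  ⟨(p.edges.map SimpleGraph.Dart.symm).reverse, by simpa [EdgePath.edges] using p.2.1, by
    rw [List.isChain_reverse, List.isChain_map]
    refine p.2.2.imp ?_
    rintro a b ⟨h1, h2⟩
    refine ⟨h1.symm, fun h => h2 ?_⟩
    rw [← SimpleGraph.Dart.symm_symm b]
    exact h.symm⟩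

theorem EdgePath.rev_rev (p : EdgePath T) : p.rev.rev = p := by
  apply Subtype.ext
  simp [EdgePath.rev, EdgePath.edges, List.map_reverse]

/-- The action of an automorphism on oriented edges. -/
def dartMap (g : T ≃g T) (e : T.Dart) : T.Dart := ⟨(g e.fst, g e.snd), g.map_rel_iff.2 e.adj⟩

theorem dartMap_symm (g : T ≃g T) (e : T.Dart) : dartMap g e.symm = (dartMap g e).symm := rfl

theorem dartMap_injective (g : T ≃g T) : Function.Injective (dartMap g) := by
  intro a b h
  have h1 := congrArg (fun e : T.Dart => e.fst) h
  have h2 := congrArg (fun e : T.Dart => e.snd) h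
  exact SimpleGraph.Dart.ext _ _ (Prod.ext (g.injective h1) (g.injective h2))

/-- The action of an automorphism on paths. -/
def EdgePath.map (g : T ≃g T) (p : EdgePath T) : EdgePath T :=
  ⟨p.edges.map (dartMap g), by simpa [EdgePath.edges] using p.2.1, by
    rw [List.isChain_map]
    refine p.2.2.imp ?_
    rintro a b ⟨h1, h2⟩
    exact ⟨congrArg g h1, fun h => h2 (dartMap_injective g h)⟩⟩

theorem EdgePath.map_one (p : EdgePath T) : EdgePath.map 1 p = p :=
  Subtype.ext (List.map_id p.1)

theorem EdgePath.map_mul (g h : T ≃g T) (p : EdgePath T) :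
    EdgePath.map (g * h) p = EdgePath.map g (EdgePath.map h p) :=
  Subtype.ext (List.map_map (l := p.1) (g := dartMap g) (f := dartMap h)).symm

theorem EdgePath.map_rev (g : T ≃g T) (p : EdgePath T) : EdgePath.map g p.rev = (EdgePath.map g p).rev := by
  apply Subtype.ext
  simp [EdgePath.map, EdgePath.rev, EdgePath.edges, List.map_reverse, Function.comp_def, dartMap_symm]

theorem EdgePath.length_map (g : T ≃g T) (p : EdgePath T) : (EdgePath.map g p).length = p.length :=
  List.length_map _

/-- The permutation of the set of paths given by an automorphism. -/
def EdgePath.perm (g : T ≃g T) : EdgePath T ≃ EdgePath T where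
  toFun := EdgePath.map g
  invFun := EdgePath.map g⁻¹
  left_inv p := by rw [← EdgePath.map_mul, inv_mul_cancel, EdgePath.map_one]
  right_inv p := by rw [← EdgePath.map_mul, mul_inv_cancel, EdgePath.map_one]

variable (T)

/-- The elements of the free vector space on paths that change sign under reversal. -/
def pathSubmodule : Submodule ℝ (EdgePath T →₀ ℝ) where
  carrier := {α | ∀ p, α p.rev = -α p}
  add_mem' := by
    intro α β hα hβ p
    simp only [Finsupp.add_apply, hα p, hβ p]
    ring
  zero_mem' := by
    intro p
    simp
  smul_mem' := by
    intro c α hα p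
    simp [hα p]

/-- The path module. -/
def PathModule : Type _ := pathSubmodule T

instance : AddCommGroup (PathModule T) := inferInstanceAs (AddCommGroup (pathSubmodule T))
instance : Module ℝ (PathModule T) := inferInstanceAs (Module ℝ (pathSubmodule T))

/-- The finitely supported function on paths underlying an element of the path module. -/
def PathModule.coeff : PathModule T →ₗ[ℝ] (EdgePath T →₀ ℝ) := (pathSubmodule T).subtype

theorem PathModule.coeff_injective : Function.Injective (PathModule.coeff T) :=
  (pathSubmodule T).injective_subtype

/-- The norm `∑ₙ (1 / n!) ‖·‖ₙ,₁`, where `‖·‖ₙ,₁` is the `ℓ¹`-norm of the restriction to the paths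
of length `n`. -/
instance : Norm (PathModule T) where
  norm α := (PathModule.coeff T α).sum fun p a => |a| / (p.length.factorial : ℝ)

theorem PathModule.norm_def (α : PathModule T) :
    ‖α‖ = (PathModule.coeff T α).sum fun p a => |a| / (p.length.factorial : ℝ) := rfl

theorem PathModule.core : NormedSpace.Core ℝ (PathModule T) where
  norm_nonneg α := Finset.sum_nonneg fun p _ => by positivity
  norm_smul c α := by
    classical
    rw [PathModule.norm_def, PathModule.norm_def, map_smul, Finsupp.sum_smul_index (by simp),
      Finsupp.mul_sum]
    exact Finset.sum_congr rfl fun p _ => by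
      simp only [abs_mul, mul_div_assoc, Real.norm_eq_abs]
  norm_triangle α β := by
    classical
    rw [PathModule.norm_def, PathModule.norm_def, PathModule.norm_def, map_add]
    set a := PathModule.coeff T α
    set b := PathModule.coeff T β
    rw [Finsupp.sum_of_support_subset (a + b) Finsupp.support_add _ (by simp),
      Finsupp.sum_of_support_subset a (Finset.subset_union_left (s₂ := b.support)) _ (by simp),
      Finsupp.sum_of_support_subset b (Finset.subset_union_right (s₁ := a.support)) _ (by simp),
      ← Finset.sum_add_distrib]
    refine Finset.sum_le_sum fun p _ => ?_
    rw [← add_div, Finsupp.add_apply]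
    gcongr
    exact abs_add_le _ _
  norm_eq_zero_iff α := by
    constructor
    · intro h
      apply PathModule.coeff_injective T
      rw [map_zero]
      rw [PathModule.norm_def, Finsupp.sum,
        Finset.sum_eq_zero_iff_of_nonneg (fun p _ => by positivity)] at h
      ext p
      by_contra hp
      have := h p (Finsupp.mem_support_iff.2 hp)
      have hf : (p.length.factorial : ℝ) ≠ 0 := by positivity
      rw [div_eq_zero_iff, abs_eq_zero] at this
      exact this.elim hp hf
    · rintro rfl
      rw [PathModule.norm_def, map_zero, Finsupp.sum_zero_index]

instance : NormedAddCommGroup (PathModule T) := NormedAddCommGroup.ofCore (PathModule.core T)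
instance : NormedSpace ℝ (PathModule T) := NormedSpace.ofCore (PathModule.core T)

/-- The Banach space completion of the path module. -/
abbrev PathBan : Type _ := Completion (PathModule T)

variable {T}

/-- An automorphism acts on the path module by `(g α)(p) = α (g⁻¹ p)`. -/
def actLin (g : T ≃g T) : PathModule T →ₗ[ℝ] PathModule T :=
  ((Finsupp.domLCongr (R := ℝ) (M := ℝ) (EdgePath.perm g)).toLinearMap).restrict
    (p := pathSubmodule T) (q := pathSubmodule T) (fun α hα p => by
      simp only [LinearEquiv.coe_coe, Finsupp.domLCongr_apply, Finsupp.domCongr_apply,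
        Finsupp.equivMapDomain_apply]
      have : (EdgePath.perm g).symm p.rev = ((EdgePath.perm g).symm p).rev := EdgePath.map_rev g⁻¹ p
      rw [this]
      exact hα _)

theorem coeff_actLin (g : T ≃g T) (α : PathModule T) :
    PathModule.coeff T (actLin g α) =
      Finsupp.equivMapDomain (EdgePath.perm g) (PathModule.coeff T α) := rfl

theorem actLin_mul (g h : T ≃g T) (α : PathModule T) :
    actLin (g * h) α = actLin g (actLin h α) := by
  apply PathModule.coeff_injective T
  ext p
  simp only [coeff_actLin, Finsupp.equivMapDomain_apply]
  congr 1
  exact (congrArg (fun k => EdgePath.map k p) (mul_inv_rev g h)).trans (EdgePath.map_mul h⁻¹ g⁻¹ p)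

theorem actLin_one (α : PathModule T) : actLin 1 α = α := by
  apply PathModule.coeff_injective T
  ext p
  simp only [coeff_actLin, Finsupp.equivMapDomain_apply]
  congr 1
  exact (congrArg (fun k => EdgePath.map k p) inv_one).trans (EdgePath.map_one p)

theorem norm_actLin (g : T ≃g T) (α : PathModule T) : ‖actLin g α‖ = ‖α‖ := by
  rw [PathModule.norm_def, PathModule.norm_def, coeff_actLin, Finsupp.equivMapDomain_eq_mapDomain,
    Finsupp.sum_mapDomain_index_inj (EdgePath.perm g).injective]
  exact Finset.sum_congr rfl fun p _ => by
    simp only [show (EdgePath.perm g p).length = p.length from EdgePath.length_map g p]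

/-- The action of an automorphism on the completed path module. -/
def actBan (g : T ≃g T) : PathBan T →L[ℝ] PathBan T :=
  ((actLin g).mkContinuous 1 (fun α => by rw [norm_actLin, one_mul])).completion

theorem actBan_coe (g : T ≃g T) (α : PathModule T) :
    actBan g (α : PathBan T) = ((actLin g α : PathModule T) : PathBan T) := by
  simp [actBan]

theorem actBan_mul (g h : T ≃g T) (v : PathBan T) : actBan (g * h) v = actBan g (actBan h v) := by
  induction v using Completion.induction_on with
  | hp => exact isClosed_eq (actBan _).continuous ((actBan g).continuous.comp (actBan h).continuous)
  | ih α => rw [actBan_coe, actBan_coe, actBan_coe, actLin_mul]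

theorem actBan_one (v : PathBan T) : actBan (1 : T ≃g T) v = v := by
  induction v using Completion.induction_on with
  | hp => exact isClosed_eq (actBan _).continuous continuous_id
  | ih α => rw [actBan_coe, actLin_one]

theorem norm_actBan (g : T ≃g T) (v : PathBan T) : ‖actBan g v‖ = ‖v‖ := by
  induction v using Completion.induction_on with
  | hp => exact isClosed_eq (actBan _).continuous.norm continuous_norm
  | ih α => rw [actBan_coe, Completion.norm_coe, Completion.norm_coe, norm_actLin]

variable (T)

/-- The isometric action of the automorphism group on the completed path module. -/
def pathRep : (T ≃g T) →* (PathBan T ≃ₗᵢ[ℝ] PathBan T) where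
  toFun g :=
    { toFun := actBan g
      invFun := actBan g⁻¹
      map_add' := map_add _
      map_smul' := map_smul _
      left_inv := fun v => by
        rw [← actBan_mul, inv_mul_cancel, actBan_one]
      right_inv := fun v => by
        rw [← actBan_mul, mul_inv_cancel, actBan_one]
      norm_map' := norm_actBan g }
  map_one' := LinearIsometryEquiv.ext actBan_one
  map_mul' g h := LinearIsometryEquiv.ext (actBan_mul g h)

variable {T}

/-- The edges of the path `[x, y]` in a tree. -/
def geod (hT : T.IsTree) (x y : V) : List T.Dart := (hT.existsUnique_path x y).choose.darts

theorem not_mem_symm_geod (hT : T.IsTree) (x y : V) {e : T.Dart} (he : e ∈ geod hT x y) :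
    e.symm ∉ geod hT x y := by
  intro h
  have hp : (hT.existsUnique_path x y).choose.IsPath := (hT.existsUnique_path x y).choose_spec.1
  exact e.symm_ne (List.inj_on_of_nodup_map hp.isTrail.edges_nodup h he e.edge_symm)

theorem not_infix_rev (hT : T.IsTree) (x y : V) (p : EdgePath T) (hp : p.edges <:+: geod hT x y) :
    ¬ p.rev.edges <:+: geod hT x y := by
  intro h
  obtain ⟨e, he⟩ := List.exists_mem_of_ne_nil _ p.2.1
  refine not_mem_symm_geod hT x y (hp.subset he) (h.subset ?_)
  change e.symm ∈ (p.1.map SimpleGraph.Dart.symm).reverse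
  exact List.mem_reverse.2 (List.mem_map_of_mem he)

open Classical in
/-- The values of `θ(x₀, x₁)`: `1` if `p` is a sub-path of `[x₀, x₁]`, `-1` if the reverse of `p`
is, and `0` otherwise. -/
def thetaFun (hT : T.IsTree) (x₀ x₁ : V) (p : EdgePath T) : ℝ :=
  if p.edges <:+: geod hT x₀ x₁ then 1
  else if p.rev.edges <:+: geod hT x₀ x₁ then -1
  else 0

theorem thetaFun_support (hT : T.IsTree) (x₀ x₁ : V) :
    (Function.support (thetaFun hT x₀ x₁)).Finite := by
  have hf : {p : EdgePath T | p.edges <:+: geod hT x₀ x₁}.Finite := by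
    refine Set.Finite.of_finite_image (f := Subtype.val) ?_ Subtype.val_injective.injOn
    refine (List.finite_toSet ((geod hT x₀ x₁).sublists)).subset ?_
    rintro _ ⟨p, hp, rfl⟩
    exact List.mem_sublists.2 (List.IsInfix.sublist hp)
  refine (hf.union (hf.image EdgePath.rev)).subset fun p hp => ?_
  by_cases h1 : p.edges <:+: geod hT x₀ x₁
  · exact Or.inl h1
  · by_cases h2 : p.rev.edges <:+: geod hT x₀ x₁
    · exact Or.inr ⟨p.rev, h2, p.rev_rev⟩
    · exact absurd (by simp [thetaFun, h1, h2]) hp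

/-- The map `θ : V² → P`. -/
def theta (hT : T.IsTree) (x₀ x₁ : V) : PathModule T :=
  ⟨Finsupp.ofSupportFinite (thetaFun hT x₀ x₁) (thetaFun_support hT x₀ x₁), fun p => by
    change thetaFun hT x₀ x₁ p.rev = -thetaFun hT x₀ x₁ p
    by_cases h1 : p.edges <:+: geod hT x₀ x₁
    · simp [thetaFun, h1, p.rev_rev, not_infix_rev hT x₀ x₁ p h1]
    · by_cases h2 : p.rev.edges <:+: geod hT x₀ x₁ <;> simp [thetaFun, h1, h2, p.rev_rev]⟩

/-- The coboundary `ω = dθ : V³ → P`. -/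
def omega (hT : T.IsTree) : (Fin 3 → V) → PathModule T :=
  BddCoh.d V (PathModule T) 1 (fun x => theta hT (x 0) (x 1))

/-- A map `φ : V^(n+1) → E` gives, through the orbit map of a base vertex `v`, a cochain
`(g₀, …, gₙ) ↦ φ (g₀ v, …, gₙ v)` on the automorphism group. -/
def orbitCochain {E : Type*} {n : ℕ} (v : V) (φ : (Fin (n + 1) → V) → E) :
    (Fin (n + 1) → (T ≃g T)) → E :=
  fun g => φ (fun i => g i v)

/-- The map `ω`, with values in the completed path module, as a cochain on the automorphism
group. This is the standard passage from equivariant cochains on `V` to continuous cochains on the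
automorphism group, for a chosen base vertex `v`. -/
def omegaCochain (hT : T.IsTree) (v : V) : (Fin 3 → (T ≃g T)) → PathBan T :=
  orbitCochain v (fun x => ((omega hT x : PathModule T) : PathBan T))

end Graph

end TreePaths

/-! ### The tree of a free group, and Brooks quasimorphisms -/

namespace Brooks

open TreePaths

variable {F : Type*} [Group F] {ι : Type*} (b : FreeGroupBasis ι F)

/-- A letter is a generator `(i, true)` or the inverse of a generator `(i, false)`. -/
def letter (s : ι × Bool) : F := if s.2 then b s.1 else (b s.1)⁻¹

theorem repr_letter (s : ι × Bool) : b.repr (letter b s) = FreeGroup.mk [s] := by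
  rcases s with ⟨i, _ | _⟩
  · simp [letter, FreeGroup.of, FreeGroup.inv_mk, FreeGroup.invRev]
  · simp [letter, FreeGroup.of]

theorem letter_inv (s : ι × Bool) : letter b (s.1, !s.2) = (letter b s)⁻¹ := by
  rcases s with ⟨i, _ | _⟩ <;> simp [letter]

theorem mk_injOn_isReduced {w w' : List (ι × Bool)} (hw : FreeGroup.IsReduced w)
    (hw' : FreeGroup.IsReduced w') (h : FreeGroup.mk w = FreeGroup.mk w') : w = w' := by
  classical
  rw [← hw.reduce_eq, ← hw'.reduce_eq]
  exact FreeGroup.reduce.sound h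

theorem letter_ne_one (s : ι × Bool) : letter b s ≠ 1 := by
  intro h
  have h1 : FreeGroup.mk [s] = FreeGroup.mk [] := by
    rw [← repr_letter b s, h, map_one]
    rfl
  simpa using mk_injOn_isReduced .singleton .nil h1

/-- The Cayley graph: `x` is joined to `x s` for every letter `s`. -/
def cayley : SimpleGraph F where
  Adj x y := ∃ s : ι × Bool, y = x * letter b s
  symm := ⟨by
    rintro x y ⟨s, rfl⟩
    exact ⟨(s.1, !s.2), by rw [letter_inv, mul_inv_cancel_right]⟩⟩
  loopless := ⟨by
    rintro x ⟨s, hs⟩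
    exact letter_ne_one b s (by simpa using hs)⟩

/-- The word `w` labels the sequence of oriented edges `l` if the `i`-th edge goes from some `x`
to `x s`, where `s` is the `i`-th letter of `w`. -/
def Labels (w : List (ι × Bool)) (l : List (cayley b).Dart) : Prop :=
  List.Forall₂ (fun s e => e.snd = e.fst * letter b s) w l

theorem exists_labels {x y : F} (p : (cayley b).Walk x y) (hp : p.IsPath) :
    ∃ w, FreeGroup.IsReduced w ∧ Labels b w p.darts ∧ b.repr (x⁻¹ * y) = FreeGroup.mk w := by
  induction p with
  | nil => exact ⟨[], .nil, .nil, by rw [inv_mul_cancel, map_one]; rfl⟩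
  | @cons x u y h p ih =>
    rw [SimpleGraph.Walk.cons_isPath_iff] at hp
    obtain ⟨w, hw, hl, hr⟩ := ih hp.1
    obtain ⟨s, hs⟩ := h
    refine ⟨s :: w, ?_, .cons hs hl, ?_⟩
    · cases w with
      | nil => exact .singleton
      | cons t w =>
        refine FreeGroup.isReduced_cons_cons.2 ⟨fun h1 => ?_, hw⟩
        by_contra h2
        have ht : t = (s.1, !s.2) := by
          refine Prod.ext h1.symm ?_
          revert h2
          cases s.2 <;> cases t.2 <;> simp
        cases p with
        | nil => cases hl
        | cons h' p =>
          have h3 := (List.forall₂_cons.1 hl).1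
          refine hp.2 ?_
          simp only [ht, letter_inv, hs, mul_inv_cancel_right] at h3
          rw [SimpleGraph.Walk.support_cons]
          refine List.mem_cons_of_mem _ ?_
          rw [← h3]
          exact p.start_mem_support
    · rw [show x⁻¹ * y = letter b s * (u⁻¹ * y) by rw [hs]; group, map_mul, hr, repr_letter,
        FreeGroup.mul_mk]
      rfl

theorem walk_eq_of_labels {x y : F} (p q : (cayley b).Walk x y) (w : List (ι × Bool))
    (hp : Labels b w p.darts) (hq : Labels b w q.darts) : p = q := by
  induction p generalizing w with
  | nil =>
    cases hp
    cases q with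
    | nil => rfl
    | cons h q => cases hq
  | @cons x u y h p ih =>
    cases w with
    | nil => cases hp
    | cons s w =>
      cases q with
      | nil => cases hq
      | @cons _ u' _ h' q =>
        have hp' := List.forall₂_cons.1 hp
        have hq' := List.forall₂_cons.1 hq
        obtain rfl : u = u' := hp'.1.trans hq'.1.symm
        rw [ih q w hp'.2 hq'.2]

theorem reachable_mul (w : List (ι × Bool)) (x : F) :
    (cayley b).Reachable x (x * b.repr.symm (FreeGroup.mk w)) := by
  induction w generalizing x with
  | nil =>
    rw [← FreeGroup.one_eq_mk, map_one, mul_one]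
  | cons s w ih =>
    have h1 : (cayley b).Adj x (x * letter b s) := ⟨s, rfl⟩
    have h2 : b.repr.symm (FreeGroup.mk (s :: w)) =
        letter b s * b.repr.symm (FreeGroup.mk w) := by
      rw [MulEquiv.symm_apply_eq, map_mul, repr_letter, MulEquiv.apply_symm_apply,
        FreeGroup.mul_mk]
      rfl
    rw [h2, ← mul_assoc]
    exact h1.reachable.trans (ih _)

theorem cayley_isTree : (cayley b).IsTree where
  connected :=
    { preconnected := fun x y => by
        classical
        have h := reachable_mul b (b.repr (x⁻¹ * y)).toWord x
        rwa [FreeGroup.mk_toWord, MulEquiv.symm_apply_apply, mul_inv_cancel_left] at h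
      nonempty := ⟨1⟩ }
  isAcyclic := SimpleGraph.isAcyclic_iff_subsingleton_path.2 fun x y => ⟨fun p q => by
    obtain ⟨w, hw, hl, hr⟩ := exists_labels b p.1 p.2
    obtain ⟨w', hw', hl', hr'⟩ := exists_labels b q.1 q.2
    obtain rfl : w = w' := mk_injOn_isReduced hw hw' (hr.symm.trans hr')
    exact Subtype.ext (walk_eq_of_labels b _ _ w hl hl')⟩

/-- The embedding of `F` in the automorphism group of its tree by left multiplication. -/
def leftMul : F →* (cayley b ≃g cayley b) where
  toFun g :=
    { toEquiv := Equiv.mulLeft g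
      map_rel_iff' := by
        intro x y
        simp [cayley, mul_assoc] }
  map_one' := by
    ext x
    simp
  map_mul' g h := by
    ext x
    simp

theorem labels_map (g : F) (w : List (ι × Bool)) (p : EdgePath (cayley b)) :
    Labels b w (EdgePath.map (leftMul b g) p).edges ↔ Labels b w p.edges := by
  have : (EdgePath.map (leftMul b g) p).edges = p.edges.map (dartMap (leftMul b g)) := rfl
  rw [this, Labels, Labels, List.forall₂_map_right_iff]
  simp [dartMap, leftMul, mul_assoc]

open Classical in
/-- The value of the linear form `λ_w` on an individual path `p`: `1` if `w` labels `p`, `-1` if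
`w` labels the reverse of `p`, and `0` otherwise. -/
def pathSign (w : List (ι × Bool)) (p : EdgePath (cayley b)) : ℝ :=
  if Labels b w p.edges then 1
  else if Labels b w p.rev.edges then -1
  else 0

theorem pathSign_map (g : F) (w : List (ι × Bool)) (p : EdgePath (cayley b)) :
    pathSign b w (EdgePath.map (leftMul b g) p) = pathSign b w p := by
  classical
  unfold pathSign
  rw [← EdgePath.map_rev]
  exact if_congr (labels_map b g w p) rfl (if_congr (labels_map b g w p.rev) rfl rfl)

/-- The linear form `λ_w` on the path module. An individual path `p` stands for the element
`p - p.rev` of the path module; with the factor `1 / 2`, the value of `λ_w` on that element is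
`pathSign b w p`. -/
def lambdaLin (w : List (ι × Bool)) : PathModule (cayley b) →ₗ[ℝ] ℝ :=
  (1 / 2 : ℝ) • (Finsupp.linearCombination ℝ (pathSign b w)).comp (PathModule.coeff (cayley b))

theorem pathSign_bound (w : List (ι × Bool)) (p : EdgePath (cayley b)) :
    |pathSign b w p| ≤ (w.length.factorial : ℝ) / (p.length.factorial : ℝ) := by
  have hp : (0 : ℝ) < (p.length.factorial : ℝ) := by positivity
  have hl : p.rev.length = p.length := by simp [EdgePath.length, EdgePath.rev, EdgePath.edges]
  unfold pathSign
  split_ifs with h1 h2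
  · have : w.length = p.length := h1.length_eq
    rw [this, div_self hp.ne', abs_one]
  · have : w.length = p.length := h2.length_eq.trans hl
    rw [this, div_self hp.ne', abs_neg, abs_one]
  · rw [abs_zero]
    positivity

theorem lambdaLin_bound (w : List (ι × Bool)) (α : PathModule (cayley b)) :
    ‖lambdaLin b w α‖ ≤ (w.length.factorial : ℝ) * ‖α‖ := by
  have h1 : |(Finsupp.linearCombination ℝ (pathSign b w)) (PathModule.coeff (cayley b) α)| ≤
      (w.length.factorial : ℝ) * ‖α‖ := by
    rw [Finsupp.linearCombination_apply, PathModule.norm_def, Finsupp.mul_sum]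
    refine (Finset.abs_sum_le_sum_abs _ _).trans (Finset.sum_le_sum fun p _ => ?_)
    simp only [smul_eq_mul, abs_mul]
    rw [mul_div_left_comm]
    exact mul_le_mul_of_nonneg_left (pathSign_bound b w p) (abs_nonneg _)
  have h2 : ‖lambdaLin b w α‖ =
      1 / 2 * |(Finsupp.linearCombination ℝ (pathSign b w)) (PathModule.coeff (cayley b) α)| := by
    simp [lambdaLin]
  rw [h2]
  have := abs_nonneg ((Finsupp.linearCombination ℝ (pathSign b w)) (PathModule.coeff (cayley b) α))
  linarith

/-- The bounded linear form `λ_w` on the completed path module. -/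
def lambda (w : List (ι × Bool)) : PathBan (cayley b) →L[ℝ] ℝ :=
  ((lambdaLin b w).mkContinuous _ (lambdaLin_bound b w)).fromCompletion

theorem lambda_coe (w : List (ι × Bool)) (α : PathModule (cayley b)) :
    lambda b w (α : PathBan (cayley b)) = lambdaLin b w α := by
  simp [lambda]

theorem lambdaLin_act (w : List (ι × Bool)) (g : F) (α : PathModule (cayley b)) :
    lambdaLin b w (actLin (leftMul b g) α) = lambdaLin b w α := by
  simp only [lambdaLin, LinearMap.smul_apply, LinearMap.comp_apply, coeff_actLin,
    Finsupp.equivMapDomain_eq_mapDomain, Finsupp.linearCombination_mapDomain]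
  congr 3
  funext p
  exact pathSign_map b g w p

/-- `λ_w` is `F`-invariant (`1` being the trivial action of `F` on `ℝ`). -/
theorem lambda_invariant (w : List (ι × Bool)) (g : F) (v : PathBan (cayley b)) :
    lambda b w (((pathRep (cayley b)).comp (leftMul b)) g v) =
      (1 : F →* (ℝ ≃ₗᵢ[ℝ] ℝ)) g (lambda b w v) := by
  change lambda b w (actBan (leftMul b g) v) = lambda b w v
  induction v using Completion.induction_on with
  | hp =>
    exact isClosed_eq ((lambda b w).continuous.comp (actBan _).continuous) (lambda b w).continuous
  | ih α => rw [actBan_coe, lambda_coe, lambda_coe, lambdaLin_act]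

open Classical in
/-- The number of occurrences of `w` in `l` as a subword of consecutive letters, overlaps being
allowed. -/
def occ (w l : List (ι × Bool)) : ℕ := l.tails.countP (fun t => decide (w <+: t))

open Classical in
/-- The reduced word of an element of `F`. -/
def word (g : F) : List (ι × Bool) := (b.repr g).toWord

/-- The counting function `f_w`. -/
def count (w : List (ι × Bool)) (g : F) : ℝ := (occ w (word b g) : ℝ) - occ w (word b g⁻¹)

/-- The coboundary of a function `f` on `F`, as a homogeneous cochain: the coboundary of
`(g₀, g₁) ↦ f (g₀⁻¹ g₁)`. -/
def quasiCochain (f : F → ℝ) : (Fin 3 → F) → ℝ :=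
  BddCoh.d F ℝ 1 (fun x => f ((x 0)⁻¹ * x 1))

end Brooks

end

/-! The map `theta` is almost additive along geodesics. Cutting `[x, y]` at one of its vertices `c`
loses only the sub-paths that cross `c`. Such a path is determined by the numbers `i`, `j` of its
edges on the two sides of `c`, and `p - p.rev` has norm at most `2 / (i + j)! ≤ 2 / (i! j!)`. The
defect is therefore at most `2e²`, however long the geodesic is (`norm_theta_sub_le`); this is what
the factorial weights are for. Three vertices of a tree have a median (`exists_median`). Cutting the
three sides there, the half-sides cancel in `omega` by antisymmetry of `theta`, which leaves three
defects and the bound `6e²` (`norm_omega_le`).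

Thus `omega` is a bounded cocycle that is the coboundary of an equivariant but possibly unbounded
cochain. Two base vertices give versions of that cochain at bounded distance from each other, so the
class does not depend on the vertex (`mk_omegaCochain_eq`).

Finally, `theta` of `x`, `y` is the sum of `p - p.rev` over the sub-paths `p` of `[x, y]`. Hence
`λ_w` counts the sub-paths labelled by `w` minus those whose reverse is, which are the occurrences
of `w` in the reduced words of `x⁻¹y` and of its inverse (`lambda_theta`). With base vertex `1` the
orbit map of `F` is the identity, so `λ_w ∘ ω` equals the coboundary of `f_w` already as a cochain
(`lambda_omegaCochain`). -/

noncomputable section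

namespace TreePaths

variable {V : Type*} {T : SimpleGraph V}

/-! ### Geodesics and medians in a tree -/

section Geodesics

theorem geod_eq_darts (hT : T.IsTree) {x y : V} {p : T.Walk x y} (hp : p.IsPath) :
    geod hT x y = p.darts :=
  congrArg SimpleGraph.Walk.darts
    ((hT.existsUnique_path x y).unique (hT.existsUnique_path x y).choose_spec.1 hp)

theorem geod_nodup (hT : T.IsTree) (x y : V) : (geod hT x y).Nodup :=
  SimpleGraph.Walk.darts_nodup_of_support_nodup
    (hT.existsUnique_path x y).choose_spec.1.support_nodup

theorem geod_isChain (hT : T.IsTree) (x y : V) : (geod hT x y).IsChain (Succ T) := by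
  have h := (hT.existsUnique_path x y).choose.isChain_dartAdj_darts
  change (geod hT x y).IsChain T.DartAdj at h
  rw [List.isChain_iff_getElem] at h ⊢
  -- Backtracking would put an edge and its reverse on the same geodesic.
  exact fun i hi => ⟨h i hi, fun h' =>
    not_mem_symm_geod hT x y (List.getElem_mem _) (h' ▸ List.getElem_mem hi)⟩

theorem geod_comm (hT : T.IsTree) (x y : V) :
    geod hT y x = ((geod hT x y).map SimpleGraph.Dart.symm).reverse := by
  obtain ⟨p, hp, -⟩ := hT.existsUnique_path x y
  rw [geod_eq_darts hT hp, geod_eq_darts hT hp.reverse, SimpleGraph.Walk.darts_reverse]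

theorem geod_map (hT : T.IsTree) (g : T ≃g T) (x y : V) :
    geod hT (g x) (g y) = (geod hT x y).map (dartMap g) := by
  obtain ⟨p, hp, -⟩ := hT.existsUnique_path x y
  have h : (p.map (g : T →g T)).IsPath := hp.map g.injective
  rw [geod_eq_darts hT hp]
  refine (geod_eq_darts hT h).trans ?_
  rw [SimpleGraph.Walk.darts_map]
  rfl

/-- The first vertex of a path that lies in a given set containing its endpoint. -/
theorem exists_path_first_mem {S : Set V} {z x : V} (q : T.Walk z x) (hq : q.IsPath) (hx : x ∈ S) :
    ∃ c ∈ S, ∃ r : T.Walk z c, r.IsPath ∧ r.support ⊆ q.support ∧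
      ∀ v ∈ r.support, v ∈ S → v = c := by
  induction q with
  | nil => exact ⟨_, hx, .nil, .nil, by simp, by simp⟩
  | @cons z u x h q ih =>
    rw [SimpleGraph.Walk.cons_isPath_iff] at hq
    by_cases hz : z ∈ S
    · exact ⟨z, hz, .nil, .nil, by simp, by simp⟩
    · obtain ⟨c, hc, r, hr, hsub, hfirst⟩ := ih hq.1 hx
      refine ⟨c, hc, .cons h r, ?_, ?_, ?_⟩
      · exact (SimpleGraph.Walk.cons_isPath_iff h r).2 ⟨hr, fun hz' => hq.2 (hsub hz')⟩
      · simp only [SimpleGraph.Walk.support_cons]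
        exact List.cons_subset_cons _ hsub
      · intro v hv hvS
        rw [SimpleGraph.Walk.support_cons, List.mem_cons] at hv
        rcases hv with rfl | hv
        · exact absurd hvS hz
        · exact hfirst v hv hvS

theorem isPath_append {x c y : V} {p : T.Walk x c} {q : T.Walk c y} (hp : p.IsPath)
    (hq : q.IsPath) (h : ∀ v ∈ p.support, v ∈ q.support → v = c) : (p.append q).IsPath := by
  rw [SimpleGraph.Walk.isPath_def, SimpleGraph.Walk.support_append]
  have hq' := hq.support_nodup
  rw [← q.cons_tail_support] at hq'
  refine List.Nodup.append hp.support_nodup hq'.of_cons fun v hv hv' => ?_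
  have := h v hv (List.mem_of_mem_tail hv')
  subst this
  exact (List.nodup_cons.1 hq').1 hv'

/-- Any three vertices of a tree have a median. -/
theorem exists_median (hT : T.IsTree) (x y z : V) :
    ∃ c, geod hT x y = geod hT x c ++ geod hT c y ∧ geod hT y z = geod hT y c ++ geod hT c z ∧
      geod hT x z = geod hT x c ++ geod hT c z := by
  obtain ⟨p, hp, -⟩ := hT.existsUnique_path x y
  obtain ⟨q, hq, -⟩ := hT.existsUnique_path z x
  -- The median is the point where the geodesic from `z` to `x` first meets `[x, y]`. The initial
  -- piece `r` meets `[x, y]` only at `c`, so continuing along either half of `[x, y]` gives a path.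
  obtain ⟨c, hc, r, hr, -, hfirst⟩ :=
    exists_path_first_mem (S := {v | v ∈ p.support}) q hq p.start_mem_support
  obtain ⟨p₀, p₁, hp₀, hp₁, rfl⟩ := hp.mem_support_iff_exists_append.1 hc
  have h₀ : (p₀.append r.reverse).IsPath := isPath_append hp₀ hr.reverse fun v hv hv' =>
    hfirst v (by simpa using hv') (SimpleGraph.Walk.support_subset_support_append_left _ _ hv)
  have h₁ : (p₁.reverse.append r.reverse).IsPath := isPath_append hp₁.reverse hr.reverse
    fun v hv hv' => hfirst v (by simpa using hv')
      (SimpleGraph.Walk.support_subset_support_append_right _ _ (by simpa using hv))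
  refine ⟨c, ?_, ?_, ?_⟩
  · rw [geod_eq_darts hT hp, geod_eq_darts hT hp₀, geod_eq_darts hT hp₁,
      SimpleGraph.Walk.darts_append]
  · rw [geod_eq_darts hT h₁, geod_eq_darts hT hp₁.reverse, geod_eq_darts hT hr.reverse,
      SimpleGraph.Walk.darts_append]
  · rw [geod_eq_darts hT h₀, geod_eq_darts hT hp₀, geod_eq_darts hT hr.reverse,
      SimpleGraph.Walk.darts_append]

end Geodesics

/-! ### The elements `p - p.rev`, and `theta` as their sum over sub-paths -/

section PathElements

theorem EdgePath.length_rev (p : EdgePath T) : p.rev.length = p.length := by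
  simp [EdgePath.length, EdgePath.rev, EdgePath.edges]

theorem EdgePath.edges_injective : Function.Injective (EdgePath.edges (T := T)) :=
  Subtype.val_injective

theorem EdgePath.rev_injective : Function.Injective (EdgePath.rev (T := T)) :=
  Function.LeftInverse.injective EdgePath.rev_rev

/-- The element `p - p.rev` of the path module. -/
def pathElem (p : EdgePath T) : PathModule T :=
  ⟨Finsupp.single p 1 - Finsupp.single p.rev 1, fun q => by
    classical
    have h1 : p = q.rev ↔ p.rev = q :=
      ⟨fun h => by rw [h, EdgePath.rev_rev], fun h => by rw [← h, EdgePath.rev_rev]⟩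
    have h2 : p.rev = q.rev ↔ p = q := EdgePath.rev_injective.eq_iff
    simp only [Finsupp.sub_apply, Finsupp.single_apply, h1, h2]
    ring⟩

theorem coeff_pathElem (p : EdgePath T) :
    PathModule.coeff T (pathElem p) = Finsupp.single p 1 - Finsupp.single p.rev 1 := rfl

theorem pathElem_rev (p : EdgePath T) : pathElem p.rev = -pathElem p := by
  apply PathModule.coeff_injective T
  rw [map_neg, coeff_pathElem, coeff_pathElem, EdgePath.rev_rev, neg_sub]

theorem actLin_pathElem (g : T ≃g T) (p : EdgePath T) :
    actLin g (pathElem p) = pathElem (EdgePath.map g p) := by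
  apply PathModule.coeff_injective T
  rw [coeff_actLin, coeff_pathElem, coeff_pathElem, Finsupp.equivMapDomain_eq_mapDomain,
    sub_eq_add_neg, Finsupp.mapDomain_add, ← Finsupp.single_neg, Finsupp.mapDomain_single,
    Finsupp.mapDomain_single, Finsupp.single_neg, ← sub_eq_add_neg, ← EdgePath.map_rev]
  rfl

theorem norm_pathElem_le (p : EdgePath T) : ‖pathElem p‖ ≤ 2 / (p.length.factorial : ℝ) := by
  classical
  rw [PathModule.norm_def, coeff_pathElem,
    Finsupp.sum_of_support_subset _ (s := {p, p.rev}) ?_ _ (by simp)]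
  -- No path is its own reverse, but that need not be proved: in this case the element is zero.
  · by_cases h : p = p.rev
    · rw [← h]
      simp
      positivity
    · rw [Finset.sum_pair h]
      simp [h, Ne.symm h, EdgePath.length_rev]
      apply le_of_eq
      ring
  · intro q hq
    by_contra hq'
    simp only [Finset.mem_insert, Finset.mem_singleton, not_or] at hq'
    simp [Ne.symm hq'.1, Ne.symm hq'.2] at hq

theorem infix_finite (l : List T.Dart) : {p : EdgePath T | p.edges <:+: l}.Finite := by
  refine Set.Finite.of_finite_image (f := Subtype.val) ?_ Subtype.val_injective.injOn
  refine (List.finite_toSet l.sublists).subset ?_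
  rintro _ ⟨p, hp, rfl⟩
  exact List.mem_sublists.2 (List.IsInfix.sublist hp)

/-- The sub-paths of a sequence of edges. -/
def subPaths (l : List T.Dart) : Finset (EdgePath T) := (infix_finite l).toFinset

theorem mem_subPaths {l : List T.Dart} {p : EdgePath T} : p ∈ subPaths l ↔ p.edges <:+: l := by
  simp [subPaths]

/-- A path and its reverse cannot both lie on one geodesic, so no two terms interfere. In this form,
antisymmetry, equivariance, the norm estimate and the evaluation of `λ_w` can all be checked path by
path. -/
theorem theta_eq_sum (hT : T.IsTree) (x y : V) :
    theta hT x y = ∑ p ∈ subPaths (geod hT x y), pathElem p := by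
  classical
  apply PathModule.coeff_injective T
  ext q
  have h : ∀ p : EdgePath T, p.rev = q ↔ p = q.rev := fun p =>
    ⟨fun h => by rw [← h, EdgePath.rev_rev], fun h => by rw [h, EdgePath.rev_rev]⟩
  change thetaFun hT x y q = _
  rw [map_sum, Finsupp.finsetSum_apply]
  simp only [coeff_pathElem, Finsupp.sub_apply, Finsupp.single_apply, Finset.sum_sub_distrib, h,
    Finset.sum_ite_eq', mem_subPaths]
  by_cases h1 : q.edges <:+: geod hT x y
  · simp [thetaFun, h1, not_infix_rev hT x y q h1]
  · by_cases h2 : q.rev.edges <:+: geod hT x y <;> simp [thetaFun, h1, h2]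

theorem map_infix_map {α β : Type*} {f : α → β} (hf : Function.Injective f) {l l' : List α} :
    l.map f <:+: l'.map f ↔ l <:+: l' := by
  refine ⟨?_, fun h => h.map f⟩
  rintro ⟨s, t, h⟩
  obtain ⟨a, b, rfl, h1, rfl⟩ := List.map_eq_append_iff.1 h.symm
  obtain ⟨c, e, rfl, rfl, h2⟩ := List.map_eq_append_iff.1 h1
  exact ⟨c, b, by rw [List.map_injective_iff.2 hf h2]⟩

theorem mem_subPaths_map (g : T ≃g T) {l : List T.Dart} {p : EdgePath T} :
    EdgePath.map g p ∈ subPaths (l.map (dartMap g)) ↔ p ∈ subPaths l := by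
  rw [mem_subPaths, mem_subPaths]
  exact map_infix_map (dartMap_injective g)

theorem mem_subPaths_rev {l : List T.Dart} {p : EdgePath T} :
    p.rev ∈ subPaths (l.map SimpleGraph.Dart.symm).reverse ↔ p ∈ subPaths l := by
  rw [mem_subPaths, mem_subPaths]
  rw [← map_infix_map (l := p.edges) SimpleGraph.Dart.symm_involutive.injective]
  change (p.edges.map SimpleGraph.Dart.symm).reverse <:+: _ ↔ _
  simp

theorem sum_subPaths_rev {M : Type*} [AddCommMonoid M] (l : List T.Dart) (f : EdgePath T → M) :
    ∑ p ∈ subPaths (l.map SimpleGraph.Dart.symm).reverse, f p = ∑ p ∈ subPaths l, f p.rev :=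
  (Finset.sum_bij (fun p _ => p.rev) (fun _ hp => mem_subPaths_rev.2 hp)
    (fun _ _ _ _ h => EdgePath.rev_injective h)
    (fun p hp => ⟨p.rev, mem_subPaths_rev.1 (by rwa [EdgePath.rev_rev]), p.rev_rev⟩)
    (fun _ _ => rfl)).symm

theorem theta_comm (hT : T.IsTree) (x y : V) : theta hT y x = -theta hT x y := by
  rw [theta_eq_sum, theta_eq_sum, geod_comm, sum_subPaths_rev, ← Finset.sum_neg_distrib]
  exact Finset.sum_congr rfl fun p _ => pathElem_rev p

theorem theta_map (hT : T.IsTree) (g : T ≃g T) (x y : V) :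
    theta hT (g x) (g y) = actLin g (theta hT x y) := by
  rw [theta_eq_sum, theta_eq_sum, geod_map, map_sum]
  simp only [actLin_pathElem]
  refine (Finset.sum_bij (fun p _ => EdgePath.map g p) (fun _ hp => (mem_subPaths_map g).2 hp)
    (fun _ _ _ _ h => (EdgePath.perm g).injective h) (fun p hp => ?_) (fun _ _ => rfl)).symm
  obtain ⟨q, rfl⟩ := (EdgePath.perm g).surjective p
  exact ⟨q, (mem_subPaths_map g).1 hp, rfl⟩

end PathElements

/-! ### The defect of additivity of `theta` -/

section Boundedness

/-- Such a path is fixed by the lengths `i`, `j` of its two pieces, and `i! j!` divides `(i + j)!`.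
The sum is thus dominated by a product of two partial sums of the series for `e`. -/
theorem sum_factorial_crossing_le (S : Finset (EdgePath T)) (l l' : List T.Dart)
    (hS : ∀ p ∈ S, ∃ l₁ l₂, p.edges = l₁ ++ l₂ ∧ l₁ <:+ l ∧ l₂ <+: l') :
    ∑ p ∈ S, 1 / (p.length.factorial : ℝ) ≤ Real.exp 1 ^ 2 := by
  classical
  -- A piece may be empty or all of its list, hence the ranges up to `length + 1`.
  have hS' : ∀ p : S, ∃ i : ℕ × ℕ, p.1.edges = l.drop (l.length - i.1) ++ l'.take i.2 ∧
      i.1 + i.2 = p.1.length ∧ i ∈ Finset.range (l.length + 1) ×ˢ Finset.range (l'.length + 1) := by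
    rintro ⟨p, hp⟩
    obtain ⟨l₁, l₂, h, h₁, h₂⟩ := hS p hp
    refine ⟨(l₁.length, l₂.length), ?_, ?_, ?_⟩
    · rw [h, ← List.suffix_iff_eq_drop.1 h₁, ← List.prefix_iff_eq_take.1 h₂]
    · simp [EdgePath.length, h]
    · have := h₁.length_le
      have := h₂.length_le
      simp
      omega
  choose i hi hlen hmem using hS'
  have hinj : Function.Injective i := fun p q h =>
    Subtype.ext (EdgePath.edges_injective (by rw [hi, hi, h]))
  have hexp : ∀ n : ℕ, ∑ k ∈ Finset.range n, 1 / (k.factorial : ℝ) ≤ Real.exp 1 := fun n => by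
    simpa using Real.sum_le_exp_of_nonneg zero_le_one n
  calc ∑ p ∈ S, 1 / (p.length.factorial : ℝ)
      = ∑ p : S, 1 / (p.1.length.factorial : ℝ) := (Finset.sum_coe_sort S _).symm
    _ ≤ ∑ p : S, 1 / ((i p).1.factorial : ℝ) * (1 / ((i p).2.factorial : ℝ)) := by
        refine Finset.sum_le_sum fun p _ => ?_
        rw [← hlen p, one_div_mul_one_div]
        refine one_div_le_one_div_of_le (by positivity) ?_
        exact_mod_cast Nat.le_of_dvd (Nat.factorial_pos _)
          (Nat.factorial_mul_factorial_dvd_factorial_add _ _)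
    _ = ∑ k ∈ Finset.univ.image i, 1 / (k.1.factorial : ℝ) * (1 / (k.2.factorial : ℝ)) :=
        (Finset.sum_image (f := fun k : ℕ × ℕ => 1 / (k.1.factorial : ℝ) *
          (1 / (k.2.factorial : ℝ))) hinj.injOn).symm
    _ ≤ ∑ k ∈ Finset.range (l.length + 1) ×ˢ Finset.range (l'.length + 1),
          1 / (k.1.factorial : ℝ) * (1 / (k.2.factorial : ℝ)) := by
        refine Finset.sum_le_sum_of_subset_of_nonneg ?_ fun k _ _ => by positivity
        intro k hk
        obtain ⟨p, -, rfl⟩ := Finset.mem_image.1 hk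
        exact hmem p
    _ = (∑ k ∈ Finset.range (l.length + 1), 1 / (k.factorial : ℝ)) *
          ∑ k ∈ Finset.range (l'.length + 1), 1 / (k.factorial : ℝ) :=
        by
        rw [Finset.sum_mul_sum, Finset.sum_product]
    _ ≤ Real.exp 1 ^ 2 := by
        rw [sq]
        exact mul_le_mul (hexp _) (hexp _) (Finset.sum_nonneg fun k _ => by positivity)
          (Real.exp_nonneg _)

/-- Sub-paths contained in one half cancel, so only those crossing `c` remain. The factor `2` comes
from the two terms of `p - p.rev`. -/
theorem norm_theta_sub_le (hT : T.IsTree) {x c y : V}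
    (h : geod hT x y = geod hT x c ++ geod hT c y) :
    ‖theta hT x y - theta hT x c - theta hT c y‖ ≤ 2 * Real.exp 1 ^ 2 := by
  classical
  have hdisj : Disjoint (subPaths (geod hT x c)) (subPaths (geod hT c y)) := by
    rw [Finset.disjoint_left]
    intro p hp hp'
    obtain ⟨e, he⟩ := List.exists_mem_of_ne_nil _ p.2.1
    have hn := geod_nodup hT x y
    rw [h] at hn
    exact List.disjoint_of_nodup_append hn ((mem_subPaths.1 hp).subset he)
      ((mem_subPaths.1 hp').subset he)
  have hsub : subPaths (geod hT x c) ∪ subPaths (geod hT c y) ⊆ subPaths (geod hT x y) := by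
    intro p hp
    rw [Finset.mem_union, mem_subPaths, mem_subPaths] at hp
    rw [mem_subPaths, h, List.infix_append_iff]
    tauto
  rw [theta_eq_sum, theta_eq_sum, theta_eq_sum, sub_sub, ← Finset.sum_union hdisj,
    ← Finset.sum_sdiff hsub, add_sub_cancel_right]
  calc _ ≤ ∑ p ∈ subPaths (geod hT x y) \ (subPaths (geod hT x c) ∪ subPaths (geod hT c y)),
          2 * (1 / (p.length.factorial : ℝ)) :=
        norm_sum_le_of_le _ fun p _ => by
          rw [mul_one_div]
          exact norm_pathElem_le p
    _ ≤ 2 * Real.exp 1 ^ 2 := by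
        rw [← Finset.mul_sum]
        refine mul_le_mul_of_nonneg_left
          (sum_factorial_crossing_le _ (geod hT x c) (geod hT c y) fun p hp => ?_) zero_le_two
        rw [Finset.mem_sdiff, Finset.mem_union, mem_subPaths, mem_subPaths, mem_subPaths, h,
          List.infix_append_iff] at hp
        tauto

end Boundedness

end TreePaths

/-! ### The coboundary in low degrees -/

namespace BddCoh

theorem d_one_apply {X E : Type*} [AddCommGroup E] [Module ℝ E] (h : X → X → E) (x : Fin 3 → X) :
    d X E 1 (fun x => h (x 0) (x 1)) x = h (x 1) (x 2) - h (x 0) (x 2) + h (x 0) (x 1) := by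
  simp [d, Fin.sum_univ_succ, Fin.succAbove, sub_eq_add_neg, add_assoc]

theorem d_d_one {X E : Type*} [AddCommGroup E] [Module ℝ E] (h : X → X → E) :
    d X E 2 (d X E 1 (fun x => h (x 0) (x 1))) = 0 := by
  funext x
  change ∑ i : Fin 4, (-1 : ℝ) ^ (i : ℕ) •
    d X E 1 (fun x => h (x 0) (x 1)) (fun j => x (i.succAbove j)) = 0
  simp only [d_one_apply]
  have h3 : (-1 : ℝ) ^ 3 = -1 := by norm_num
  simp [Fin.sum_univ_succ, Fin.succAbove, h3]
  abel

end BddCoh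

/-! ### The bounded class of `omega` and its independence of the base vertex -/

namespace TreePaths

variable {V : Type*} {T : SimpleGraph V}

theorem omega_apply (hT : T.IsTree) (x : Fin 3 → V) :
    omega hT x = theta hT (x 1) (x 2) - theta hT (x 0) (x 2) + theta hT (x 0) (x 1) :=
  BddCoh.d_one_apply (theta hT) x

theorem norm_omega_le (hT : T.IsTree) (x : Fin 3 → V) : ‖omega hT x‖ ≤ 6 * Real.exp 1 ^ 2 := by
  obtain ⟨c, h01, h12, h02⟩ := exists_median hT (x 0) (x 1) (x 2)
  -- Each side is cut at the median `c`; the half-sides inserted here cancel once `theta` from `c`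
  -- to `x 1` is reversed.
  have h : omega hT x =
      (theta hT (x 1) (x 2) - theta hT (x 1) c - theta hT c (x 2)) -
      (theta hT (x 0) (x 2) - theta hT (x 0) c - theta hT c (x 2)) +
      (theta hT (x 0) (x 1) - theta hT (x 0) c - theta hT c (x 1)) := by
    rw [omega_apply, theta_comm hT c (x 1)]
    abel
  rw [h]
  refine (norm_add_le _ _).trans ?_
  have := norm_sub_le (theta hT (x 1) (x 2) - theta hT (x 1) c - theta hT c (x 2))
    (theta hT (x 0) (x 2) - theta hT (x 0) c - theta hT c (x 2))
  have := norm_theta_sub_le hT h01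
  have := norm_theta_sub_le hT h12
  have := norm_theta_sub_le hT h02
  linarith

theorem norm_theta_map (hT : T.IsTree) (g : T ≃g T) (x y : V) :
    ‖theta hT (g x) (g y)‖ = ‖theta hT x y‖ := by
  rw [theta_map, norm_actLin]

/-- Evaluation at `v` is continuous into the discrete set `V`, and every map out of a finite power
of a discrete space is continuous. -/
theorem continuous_orbitCochain {E : Type*} [TopologicalSpace E] {n : ℕ} (v : V)
    (φ : (Fin (n + 1) → V) → E) : Continuous (orbitCochain (T := T) v φ) := by
  let _ : TopologicalSpace V := ⊥
  have : DiscreteTopology V := ⟨rfl⟩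
  have h : Continuous fun g : T ≃g T => g v :=
    (continuous_apply v).comp (continuous_induced_dom (f := fun g : T ≃g T => (g : V → V)))
  exact (continuous_of_discreteTopology (f := φ)).comp
    (continuous_pi fun i => h.comp (continuous_apply i))

theorem d_orbitCochain {E : Type*} [AddCommGroup E] [Module ℝ E] {n : ℕ} (v : V)
    (φ : (Fin (n + 1) → V) → E) :
    BddCoh.d (T ≃g T) E n (orbitCochain v φ) = orbitCochain v (BddCoh.d V E n φ) := rfl

/-- The map `θ` with values in the completed path module, as an unbounded cochain on the
automorphism group. -/
def thetaCochain (hT : T.IsTree) (v : V) : (Fin 2 → (T ≃g T)) → PathBan T :=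
  orbitCochain v (fun x => ((theta hT (x 0) (x 1) : PathModule T) : PathBan T))

theorem d_thetaCochain (hT : T.IsTree) (v : V) :
    BddCoh.d (T ≃g T) (PathBan T) 1 (thetaCochain hT v) = omegaCochain hT v := by
  rw [thetaCochain, d_orbitCochain, omegaCochain]
  congr 1
  funext x
  rw [BddCoh.d_one_apply (fun a b => ((theta hT a b : PathModule T) : PathBan T)), omega_apply]
  push_cast
  rfl

theorem thetaCochain_mul (hT : T.IsTree) (v : V) (g : T ≃g T) (x : Fin 2 → (T ≃g T)) :
    thetaCochain hT v (fun i => g * x i) = pathRep T g (thetaCochain hT v x) := by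
  refine Eq.trans ?_ (actBan_coe g _).symm
  exact congrArg _ (theta_map hT g (x 0 v) (x 1 v))

theorem omegaCochain_mul (hT : T.IsTree) (v : V) (g : T ≃g T) (x : Fin 3 → (T ≃g T)) :
    omegaCochain hT v (fun i => g * x i) = pathRep T g (omegaCochain hT v x) := by
  refine Eq.trans ?_ (actBan_coe g _).symm
  refine congrArg (fun α : PathModule T => (α : PathBan T)) ?_
  rw [omega_apply, omega_apply, map_add, map_sub, ← theta_map, ← theta_map, ← theta_map]
  rfl

theorem omegaCochain_mem_cocycles (hT : T.IsTree) (v : V) :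
    omegaCochain hT v ∈ BddCoh.cocycles (pathRep T) 2 := by
  refine ⟨⟨continuous_orbitCochain v _, ⟨6 * Real.exp 1 ^ 2, fun x => ?_⟩,
    omegaCochain_mul hT v⟩, ?_⟩
  · exact (Completion.norm_coe _).trans_le (norm_omega_le hT _)
  · change BddCoh.d _ _ 2 (omegaCochain hT v) = 0
    rw [← d_thetaCochain]
    exact BddCoh.d_d_one (fun a b : T ≃g T => ((theta hT (a v) (b v) : PathModule T) : PathBan T))

/-- Moving the endpoints of a geodesic changes `θ` by an amount depending only on the
displacements. -/
theorem norm_theta_sub_theta_le (hT : T.IsTree) (x y x' y' : V) :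
    ‖theta hT x y - theta hT x' y'‖ ≤
      12 * Real.exp 1 ^ 2 + ‖theta hT x x'‖ + ‖theta hT y y'‖ := by
  have h1 := omega_apply hT ![x, x', y]
  have h2 := omega_apply hT ![x', y, y']
  simp only [Matrix.cons_val] at h1 h2
  -- The quadrilateral is cut along the diagonal from `x'` to `y` into two triangles, each
  -- contributing one value of `omega`.
  have h : theta hT x y - theta hT x' y' =
      -omega hT ![x, x', y] + omega hT ![x', y, y'] + theta hT x x' - theta hT y y' := by
    rw [h1, h2]
    abel
  rw [h]
  have := norm_omega_le hT ![x, x', y]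
  have := norm_omega_le hT ![x', y, y']
  refine (norm_sub_le _ _).trans (add_le_add_left ((norm_add_le _ _).trans
    (add_le_add_left ((norm_add_le _ _).trans ?_) _)) _)
  rw [norm_neg]
  linarith

theorem mk_omegaCochain_eq (hT : T.IsTree) (u v : V) :
    BddCoh.mk (pathRep T) 2 (omegaCochain hT u) (omegaCochain_mem_cocycles hT u) =
      BddCoh.mk (pathRep T) 2 (omegaCochain hT v) (omegaCochain_mem_cocycles hT v) := by
  refine (Submodule.Quotient.eq _).2 ?_
  change omegaCochain hT u - omegaCochain hT v ∈ (BddCoh.cochains (pathRep T) 1).map _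
  -- This difference is bounded because every automorphism `g` displaces the base vertices equally:
  -- `theta` of `g u`, `g v` has the same norm as `theta` of `u`, `v`.
  refine ⟨thetaCochain hT u - thetaCochain hT v, ⟨?_, ?_, ?_⟩, ?_⟩
  · exact (continuous_orbitCochain u _).sub (continuous_orbitCochain v _)
  · refine ⟨12 * Real.exp 1 ^ 2 + ‖theta hT u v‖ + ‖theta hT u v‖, fun x => ?_⟩
    have h := norm_theta_sub_theta_le hT (x 0 u) (x 1 u) (x 0 v) (x 1 v)
    rw [norm_theta_map, norm_theta_map] at h
    rw [← Completion.norm_coe, Completion.coe_sub] at h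
    exact h
  · intro g x
    rw [Pi.sub_apply, Pi.sub_apply, map_sub, thetaCochain_mul, thetaCochain_mul]
  · rw [map_sub, d_thetaCochain, d_thetaCochain]

end TreePaths

/-! ### Labels of geodesics and the values of `λ_w` -/

namespace Brooks

open TreePaths

variable {F : Type*} [Group F] {ι : Type*} (b : FreeGroupBasis ι F)

theorem letter_injective : Function.Injective (letter b) := by
  intro s t h
  have h1 : FreeGroup.mk [s] = FreeGroup.mk [t] := by
    rw [← repr_letter b s, ← repr_letter b t, h]
  simpa using mk_injOn_isReduced .singleton .singleton h1

theorem word_injective : Function.Injective (word b) := by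
  classical
  intro g h hgh
  exact b.repr.injective (FreeGroup.toWord_injective hgh)

theorem labels_unique {u u' : List (ι × Bool)} {l : List (cayley b).Dart} (h : Labels b u l)
    (h' : Labels b u' l) : u = u' := by
  induction h generalizing u' with
  | nil => cases h'; rfl
  | cons hs _ ih =>
    cases h' with
    | cons hs' h' =>
      rw [ih h', letter_injective b (mul_left_cancel (hs.symm.trans hs'))]

theorem labels_geod (x y : F) : Labels b (word b (x⁻¹ * y)) (geod (cayley_isTree b) x y) := by
  classical
  obtain ⟨p, hp, -⟩ := (cayley_isTree b).existsUnique_path x y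
  obtain ⟨u, hu, hl, hr⟩ := exists_labels b p hp
  rw [geod_eq_darts _ hp]
  have : word b (x⁻¹ * y) = u := by
    rw [word, hr, FreeGroup.toWord_mk]
    convert hu.reduce_eq
  rwa [this]

theorem labels_rev {u : List (ι × Bool)} {l : List (cayley b).Dart} (h : Labels b u l) :
    Labels b (FreeGroup.invRev u) (l.map SimpleGraph.Dart.symm).reverse := by
  rw [FreeGroup.invRev]
  refine List.rel_reverse ?_
  rw [List.forall₂_map_left_iff, List.forall₂_map_right_iff]
  refine h.imp fun s e hs => ?_
  change e.fst = e.snd * letter b (s.1, !s.2)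
  rw [letter_inv, hs, mul_inv_cancel_right]

/-- A word labelling both a path and its reverse equals its formal inverse, so its square is trivial
in the free group. By torsion-freeness and reducedness it is empty, while paths are not. -/
theorem not_labels_rev {w : List (ι × Bool)} (hw : FreeGroup.IsReduced w)
    {p : EdgePath (cayley b)} (h : Labels b w p.edges) : ¬ Labels b w p.rev.edges := by
  intro h'
  have h1 : w = FreeGroup.invRev w := labels_unique b h' (labels_rev b h)
  have h2 : FreeGroup.mk w ^ 2 = 1 ^ 2 := by
    rw [one_pow, sq]
    nth_rewrite 2 [h1]
    rw [← FreeGroup.inv_mk, mul_inv_cancel]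
  have h3 : FreeGroup.mk w = 1 := IsMulTorsionFree.pow_left_injective two_ne_zero h2
  have h4 : w = [] := mk_injOn_isReduced hw .nil h3
  rw [h4] at h
  have h5 : p.edges = [] := List.forall₂_nil_left_iff.1 h
  exact p.2.1 h5

open Classical in
theorem pathSign_eq {w : List (ι × Bool)} (hw : FreeGroup.IsReduced w) (p : EdgePath (cayley b)) :
    pathSign b w p =
      (if Labels b w p.edges then 1 else 0) - (if Labels b w p.rev.edges then 1 else 0) := by
  unfold pathSign
  by_cases h : Labels b w p.edges
  · simp [h, not_labels_rev b hw h]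
  · by_cases h' : Labels b w p.rev.edges <;> simp [h, h']

/-- The sign is odd under reversal, so `p` and `p.rev` contribute equally and the factor `1 / 2`
compensates. -/
theorem lambdaLin_pathElem {w : List (ι × Bool)} (hw : FreeGroup.IsReduced w)
    (p : EdgePath (cayley b)) : lambdaLin b w (pathElem p) = pathSign b w p := by
  simp only [lambdaLin, LinearMap.smul_apply, LinearMap.comp_apply, coeff_pathElem, map_sub,
    Finsupp.linearCombination_single, pathSign_eq b hw, smul_eq_mul]
  rw [EdgePath.rev_rev]
  ring

/-! ### Occurrences of a word as labelled sub-paths -/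

open Classical in
theorem occ_cons (w : List (ι × Bool)) (s : ι × Bool) (u : List (ι × Bool)) :
    occ w (s :: u) = occ w u + if w <+: s :: u then 1 else 0 := by
  simp [occ, List.countP_cons]

theorem labels_take {w u : List (ι × Bool)} {l : List (cayley b).Dart} (h : Labels b u l)
    {q : List (cayley b).Dart} (hq : q <+: l) : Labels b w q ↔ w <+: u ∧ q = l.take w.length := by
  constructor
  · intro hw
    have h1 : w = u.take q.length := by
      rw [List.prefix_iff_eq_take.1 hq] at hw
      exact labels_unique b hw (List.forall₂_take _ h)
    refine ⟨h1 ▸ ⟨_, List.take_append_drop _ _⟩, ?_⟩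
    rw [hw.length_eq]
    exact List.prefix_iff_eq_take.1 hq
  · rintro ⟨h1, rfl⟩
    have h2 := List.forall₂_take w.length h
    rwa [← List.prefix_iff_eq_take.1 h1] at h2

/-- A nonempty word occurs in `u` as often as it labels sub-paths of a path labelled by `u`. -/
theorem card_labels_subPaths {w : List (ι × Bool)} (hw : w ≠ []) {u : List (ι × Bool)}
    {l : List (cayley b).Dart} (h : Labels b u l) (hn : l.Nodup)
    (hl : l.IsChain (Succ (cayley b))) :
    {p : EdgePath (cayley b) | p.edges <:+: l ∧ Labels b w p.edges}.ncard = occ w u := by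
  classical
  induction h with
  | nil =>
    have : {p : EdgePath (cayley b) | p.edges <:+: [] ∧ Labels b w p.edges} = ∅ :=
      Set.eq_empty_of_forall_notMem fun p hp => p.2.1 (List.infix_nil.1 hp.1)
    rw [this]
    simp [occ, hw]
  | @cons s e u l hs hu ih =>
    have hlab : Labels b (s :: u) (e :: l) := .cons hs hu
    rw [occ_cons, ← ih hn.of_cons hl.tail]
    -- This mirrors the recursion for `occ`: sub-paths avoiding the first edge are counted by
    -- induction, and at most one starts with it. Since edges do not repeat, the two kinds are
    -- disjoint.
    have hsplit : {p : EdgePath (cayley b) | p.edges <:+: e :: l ∧ Labels b w p.edges} =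
        {p | p.edges <:+: l ∧ Labels b w p.edges} ∪
          {p | p.edges <+: e :: l ∧ Labels b w p.edges} := by
      ext p
      simp only [Set.mem_ofPred_eq, Set.mem_union, List.infix_cons_iff]
      tauto
    have hdisj : Disjoint {p : EdgePath (cayley b) | p.edges <:+: l ∧ Labels b w p.edges}
        {p | p.edges <+: e :: l ∧ Labels b w p.edges} := by
      rw [Set.disjoint_left]
      rintro p ⟨hp, -⟩ ⟨hp', -⟩
      obtain ⟨q, hq⟩ : ∃ q, p.edges = e :: q := by
        rcases List.prefix_cons_iff.1 hp' with h | ⟨q, h, -⟩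
        · exact absurd h p.2.1
        · exact ⟨q, h⟩
      exact (List.nodup_cons.1 hn).1 (hp.subset (by simp [hq]))
    rw [hsplit, Set.ncard_union_eq hdisj ((infix_finite l).subset fun p hp => hp.1)
      ((infix_finite (e :: l)).subset fun p hp => hp.1.isInfix)]
    congr 1
    split_ifs with hpre
    · rw [Set.ncard_eq_one]
      have hne : (e :: l).take w.length ≠ [] := by simpa using hw
      -- The chain condition on the edges is what makes this initial segment a path.
      let p₀ : EdgePath (cayley b) := ⟨(e :: l).take w.length, hne, hl.take _⟩
      refine ⟨p₀, ?_⟩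
      ext p
      rw [Set.mem_singleton_iff, ← EdgePath.edges_injective.eq_iff]
      constructor
      · rintro ⟨hp, hp'⟩
        exact ((labels_take b hlab hp).1 hp').2
      · intro hp
        change p.edges = (e :: l).take w.length at hp
        have h1 : p.edges <+: e :: l := hp ▸ ⟨_, List.take_append_drop _ _⟩
        exact ⟨h1, (labels_take b hlab h1).2 ⟨hpre, hp⟩⟩
    · have : {p : EdgePath (cayley b) | p.edges <+: e :: l ∧ Labels b w p.edges} = ∅ :=
        Set.eq_empty_of_forall_notMem fun p hp => hpre ((labels_take b hlab hp.1).1 hp.2).1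
      rw [this, Set.ncard_empty]

/-- The empty tail is counted too. Only the dependence on length alone matters: inversion preserves
length, so `count` vanishes for the empty word. -/
theorem occ_nil (u : List (ι × Bool)) : occ [] u = u.length + 1 := by
  simp [occ, List.countP_eq_length_filter]

theorem occ_nil_word_inv (g : F) : occ [] (word b g⁻¹) = occ [] (word b g) := by
  classical
  rw [occ_nil, occ_nil, word, map_inv, FreeGroup.toWord_inv, FreeGroup.invRev_length, word]

open Classical in
theorem sum_labels_subPaths {w : List (ι × Bool)} (hw : w ≠ []) (x y : F) :
    ∑ p ∈ subPaths (geod (cayley_isTree b) x y), (if Labels b w p.edges then (1 : ℝ) else 0) =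
      occ w (word b (x⁻¹ * y)) := by
  rw [← card_labels_subPaths b hw (labels_geod b x y) (geod_nodup _ x y) (geod_isChain _ x y),
    Finset.sum_boole, ← Set.ncard_coe_finset]
  congr 2
  ext p
  simp [mem_subPaths]

theorem lambda_theta {w : List (ι × Bool)} (hw : FreeGroup.IsReduced w) (x y : F) :
    lambda b w (theta (cayley_isTree b) x y : PathBan (cayley b)) = count b w (x⁻¹ * y) := by
  classical
  rw [lambda_coe, theta_eq_sum, map_sum]
  simp only [lambdaLin_pathElem b hw]
  rcases eq_or_ne w [] with rfl | hne
  · have h : ∀ p : EdgePath (cayley b), pathSign b [] p = 0 := fun p => by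
      have h1 : ∀ q : EdgePath (cayley b), ¬ Labels b [] q.edges := fun q hq =>
        q.2.1 (List.forall₂_nil_left_iff.1 hq)
      simp [pathSign, h1]
    simp only [h, count, occ_nil_word_inv b (x⁻¹ * y), Finset.sum_const_zero, sub_self]
  · simp only [pathSign_eq b hw]
    -- Reversal turns the negative part into a count over the sub-paths of `[y, x]`, which is
    -- labelled by the reduced word of the inverse element.
    rw [Finset.sum_sub_distrib, sum_labels_subPaths b hne,
      ← sum_subPaths_rev _ (fun p => if Labels b w p.edges then (1 : ℝ) else 0), ← geod_comm,
      sum_labels_subPaths b hne, count, mul_inv_rev, inv_inv]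

theorem lambda_omegaCochain {w : List (ι × Bool)} (hw : FreeGroup.IsReduced w) (x : Fin 3 → F) :
    lambda b w (omegaCochain (cayley_isTree b) 1 (fun i => leftMul b (x i))) =
      quasiCochain (count b w) x := by
  have h : ∀ g : F, leftMul b g 1 = g := mul_one
  rw [quasiCochain, BddCoh.d_one_apply (fun a c => count b w (a⁻¹ * c)), omegaCochain,
    orbitCochain, omega_apply]
  simp only [h, Completion.coe_add, Completion.coe_sub, map_add, map_sub, lambda_theta b hw]

/-- Boundedness, i.e. that `f_w` is a quasimorphism, is inherited from `omega` through the bounded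
form `λ_w`, with no separate combinatorial estimate. -/
theorem quasiCochain_mem_cocycles [TopologicalSpace F] [DiscreteTopology F]
    {w : List (ι × Bool)} (hw : FreeGroup.IsReduced w) :
    quasiCochain (count b w) ∈ BddCoh.cocycles (1 : F →* (ℝ ≃ₗᵢ[ℝ] ℝ)) 2 := by
  obtain ⟨C, hC⟩ := (omegaCochain_mem_cocycles (cayley_isTree b) 1).1.2.1
  refine ⟨⟨continuous_of_discreteTopology, ⟨‖lambda b w‖ * C, fun x => ?_⟩, fun g x => ?_⟩,
    BddCoh.d_d_one (fun a c => count b w (a⁻¹ * c))⟩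
  · rw [← lambda_omegaCochain b hw]
    exact ((lambda b w).le_opNorm _).trans (mul_le_mul_of_nonneg_left (hC _) (norm_nonneg _))
  · change quasiCochain (count b w) (fun i => g * x i) = quasiCochain (count b w) x
    simp only [quasiCochain, BddCoh.d_one_apply (fun a c => count b w (a⁻¹ * c)), mul_inv_rev,
      mul_assoc, inv_mul_cancel_left]

end Brooks

end

theorem mainTheorem5 {F : Type*} [Group F] [TopologicalSpace F] [DiscreteTopology F]
    {ι : Type*} [Finite ι] (b : FreeGroupBasis ι F)
    (w : List (ι × Bool)) (hw : FreeGroup.IsReduced w) :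
    (∀ x₀ x₁ g : F,
      Brooks.Labels b (Brooks.word b g) (TreePaths.geod (Brooks.cayley_isTree b) x₀ x₁) →
        Brooks.lambda b w
          (TreePaths.theta (Brooks.cayley_isTree b) x₀ x₁ : TreePaths.PathBan (Brooks.cayley b)) =
            Brooks.count b w g) ∧
    ∃ univClass : BddCoh.H (TreePaths.pathRep (Brooks.cayley b)) 2,
      (∀ v : F, ∃ hω : TreePaths.omegaCochain (Brooks.cayley_isTree b) v ∈
          BddCoh.cocycles (TreePaths.pathRep (Brooks.cayley b)) 2,
        univClass = BddCoh.mk (TreePaths.pathRep (Brooks.cayley b)) 2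
          (TreePaths.omegaCochain (Brooks.cayley_isTree b) v) hω) ∧
      ∃ hf : Brooks.quasiCochain (Brooks.count b w) ∈
          BddCoh.cocycles (1 : F →* (ℝ ≃ₗᵢ[ℝ] ℝ)) 2,
        BddCoh.coeffMap ((TreePaths.pathRep (Brooks.cayley b)).comp (Brooks.leftMul b))
            (1 : F →* (ℝ ≃ₗᵢ[ℝ] ℝ)) (Brooks.lambda b w) (Brooks.lambda_invariant b w) 2
            (BddCoh.res (TreePaths.pathRep (Brooks.cayley b)) (Brooks.leftMul b)
              continuous_of_discreteTopology 2 univClass) =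
          BddCoh.mk (1 : F →* (ℝ ≃ₗᵢ[ℝ] ℝ)) 2 (Brooks.quasiCochain (Brooks.count b w)) hf := by
  refine ⟨fun x₀ x₁ g hg => ?_, BddCoh.mk _ 2 _
    (TreePaths.omegaCochain_mem_cocycles (Brooks.cayley_isTree b) 1), fun v => ⟨_,
    TreePaths.mk_omegaCochain_eq (Brooks.cayley_isTree b) 1 v⟩,
    Brooks.quasiCochain_mem_cocycles b hw, ?_⟩
  · rw [Brooks.lambda_theta b hw,
      Brooks.word_injective b (Brooks.labels_unique b hg (Brooks.labels_geod b x₀ x₁))]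
  -- The class is represented at the vertex `1`, where the two cocycles coincide, so no coboundary
  -- is needed.
  · exact congrArg Submodule.Quotient.mk
      (Subtype.ext (funext fun x => Brooks.lambda_omegaCochain b hw x))
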